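/- Consider an $m$-port circuit built from finitely many LTI resistors ($v=Ri$, $R\ge 0$), ideal multi-port transformers ($\mathbf i_1=T^\top\mathbf i_2$, $\mathbf v_2=-T\mathbf v_1$, $T$ a real matrix), ideal gyrators ($v_1=\gamma i_2$, $v_2=-\gamma i_1$, $\gamma\ge 0$) and $n$ ideal diodes, connected at finitely many nodes and subject to Kirchhoff's laws. Element currents flow through the element from its positive to its negative terminal; a driving point current is counted positive if it leaves the circuit at the positive terminal. Define the set-valued maps $$Z_{\rm diode}(i)=\begin{cases}\{0\}&i>0\\(-\infty,0]&i=0\\\emptyset&i<0\end{cases}\qquad Y_{\rm diode}(v)=\begin{cases}\{0\}&v>0\\(-\infty,0]&v=0\\\emptyset&v<0.\end{cases}$$ A diode whose forward current (anode to cathode) is $i$ and whose forward voltage (anode minus cathode) is $v$ obeys $v\in Z_{\rm diode}(i)$; equivalently, in the reversed reference direction, $-i\in Y_{\rm diode}(-v)$. For a real square, not necessarily symmetric, matrix $M$, write $M\succeq 0$ if $x^\top Mx\ge 0$ for all $x$. **Theorem.** For every such circuit there exist: 1. a partition of the driving point voltages $v_k$ and currents $i_k$, $k=1,\dots,m$,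 into vectors $\mathbf u,\mathbf y\in\mathbb R^m$, where for each $k$ one of $v_k,i_k$ is the $k$-th entry of $\mathbf u$ and the other one is the $k$-th entry of $\mathbf y$; 2. integers $p+q=n$ and a division of the diodes into $p$ diodes whose forward currents form a vector $\mathbf i\in\mathbb R^p$ and $q$ diodes whose reverse voltages form a vector $\mathbf v\in\mathbb R^q$; 3. real matrices $H\in\mathbb R^{n\times n}$, $B\in\mathbb R^{n\times m}$, $C\in\mathbb R^{m\times n}$, $D\in\mathbb R^{m\times m}$ with $H\succeq 0$ and $D\succeq 0$; such that, for all real values of the driving point voltages and currents (and hence of $\mathbf u$, $\mathbf y$) and all $\mathbf i\in\mathbb R^p$, $\mathbf v\in\mathbb R^q$, the circuit has a solution with these driving point variables and these diode variables if and only if $$0\in H\begin{pmatrix}\mathbf i\\\mathbf v\end{pmatrix}+\begin{pmatrix}Z(\mathbf i)\\Y(\mathbf v)\end{pmatrix}+B\mathbf u,\qquad \mathbf y=-C\begin{pmatrix}\mathbf i\\\mathbf v\end{pmatrix}-D\mathbf u,$$ where $Z(\mathbf i)$ is the set of $w\in\mathbb R^p$ with $w[j]\in Z_{\rm diode}(\mathbf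 i[j])$ for all $j$, and $Y(\mathbf v)$ is the set of $w\in\mathbb R^q$ with $w[j]\in Y_{\rm diode}(\mathbf v[j])$ for all $j$. -/

import Mathlib

open scoped Matrix Pointwise

namespace RTGD

/-- The forward biased ideal diode, as a set-valued impedance `i ↦ v`: the value is `{0}` for
`i > 0`, `(-∞, 0]` for `i = 0`, and empty for `i < 0`. -/
def diodeImpedance (i : ℝ) : Set ℝ := {v | (0 < i ∧ v = 0) ∨ (i = 0 ∧ v ≤ 0)}

/-- The reverse biased ideal diode, as a set-valued admittance `v ↦ i`: the value is `{0}` for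
`v > 0`, `(-∞, 0]` for `v = 0`, and empty for `v < 0`. -/
def diodeAdmittance (v : ℝ) : Set ℝ := {i | (0 < v ∧ i = 0) ∨ (v = 0 ∧ i ≤ 0)}

/-- A forward biased diode and a reverse biased diode are the same device with the reference
direction (of current and voltage) reversed. -/
theorem mem_diodeImpedance_iff_neg (i v : ℝ) :
    v ∈ diodeImpedance i ↔ -i ∈ diodeAdmittance (-v) := by
  simp only [diodeImpedance, diodeAdmittance, Set.mem_ofPred_eq]
  constructor
  · rintro (⟨h, rfl⟩ | ⟨rfl, h⟩)
    · right; constructor <;> linarith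
    · rcases h.lt_or_eq with h | rfl
      · left; constructor <;> linarith
      · right; constructor <;> linarith
  · rintro (⟨h, h2⟩ | ⟨h, h2⟩)
    · right; constructor <;> linarith
    · rcases (show 0 ≤ i by linarith).lt_or_eq with h3 | h3
      · left; constructor <;> linarith
      · right; constructor <;> linarith

/-- `Z`: the forward biased diode impedance applied entrywise. -/
def Z {p : ℕ} (i : Fin p → ℝ) : Set (Fin p → ℝ) := {w | ∀ j, w j ∈ diodeImpedance (i j)}

/-- `Y`: the reverse biased diode admittance applied entrywise. -/
def Y {q : ℕ} (v : Fin q → ℝ) : Set (Fin q → ℝ) := {w | ∀ j, w j ∈ diodeAdmittance (v j)}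

/-- The stacked set `(Z(i), Y(v))`. -/
def ZY {p q : ℕ} (i : Fin p → ℝ) (v : Fin q → ℝ) : Set (Fin p ⊕ Fin q → ℝ) :=
  {w | (fun j => w (Sum.inl j)) ∈ Z i ∧ (fun j => w (Sum.inr j)) ∈ Y v}

/-- `M ⪰ 0` for a real square matrix that need not be symmetric: `xᵀ M x ≥ 0` for all `x`,
equivalently `M + Mᵀ` is positive semidefinite. -/
def PosSemidefForm {ι : Type*} [Fintype ι] (M : Matrix ι ι ℝ) : Prop :=
  ∀ x : ι → ℝ, 0 ≤ x ⬝ᵥ (M *ᵥ x)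

/-- An ordered pair of nodes: the positive and the negative terminal of a driving point or of a
port of a circuit element. The two may coincide. -/
structure Terminals (N : ℕ) where
  pos : Fin N
  neg : Fin N

/-- A circuit with `m` driving points, made of LTI resistors, ideal (multi-port) transformers,
ideal gyrators and `n` ideal diodes, connected by ideal wires at finitely many nodes. The anode of
a diode is its positive terminal. -/
structure Circuit (m n : ℕ) where
  numNodes : ℕ
  numResistors : ℕ
  numTransformers : ℕ
  numGyrators : ℕ
  /-- the pairs of terminals at which the environment is attached -/
  port : Fin m → Terminals numNodes
  diode : Fin n → Terminals numNodes
  resistor : Fin numResistors → Terminals numNodes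
  resistance : Fin numResistors → ℝ
  resistance_nonneg : ∀ k, 0 ≤ resistance k
  /-- number of ports of a transformer on its first side -/
  numFirst : Fin numTransformers → ℕ
  /-- number of ports of a transformer on its second side -/
  numSecond : Fin numTransformers → ℕ
  turnsRatio : ∀ t, Matrix (Fin (numSecond t)) (Fin (numFirst t)) ℝ
  transformerFirst : ∀ t, Fin (numFirst t) → Terminals numNodes
  transformerSecond : ∀ t, Fin (numSecond t) → Terminals numNodes
  gyrator : Fin numGyrators → Fin 2 → Terminals numNodes
  gyration : Fin numGyrators → ℝ
  gyration_nonneg : ∀ k, 0 ≤ gyration k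

namespace Circuit

variable {m n : ℕ}

/-- The branches of the circuit graph: one for each driving point (standing for the environment),
diode, resistor, transformer port and gyrator port. -/
abbrev Branch (C : Circuit m n) : Type :=
  Fin m ⊕ Fin n ⊕ Fin C.numResistors ⊕
    (Σ t : Fin C.numTransformers, Fin (C.numFirst t) ⊕ Fin (C.numSecond t)) ⊕
    (Fin C.numGyrators × Fin 2)

def portBranch (C : Circuit m n) (k : Fin m) : C.Branch := Sum.inl k

def diodeBranch (C : Circuit m n) (k : Fin n) : C.Branch := Sum.inr (Sum.inl k)

def resistorBranch (C : Circuit m n) (k : Fin C.numResistors) : C.Branch :=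
  Sum.inr (Sum.inr (Sum.inl k))

def firstBranch (C : Circuit m n) (t : Fin C.numTransformers) (k : Fin (C.numFirst t)) :
    C.Branch := Sum.inr (Sum.inr (Sum.inr (Sum.inl ⟨t, Sum.inl k⟩)))

def secondBranch (C : Circuit m n) (t : Fin C.numTransformers) (k : Fin (C.numSecond t)) :
    C.Branch := Sum.inr (Sum.inr (Sum.inr (Sum.inl ⟨t, Sum.inr k⟩)))

def gyratorBranch (C : Circuit m n) (g : Fin C.numGyrators) (k : Fin 2) : C.Branch :=
  Sum.inr (Sum.inr (Sum.inr (Sum.inr (g, k))))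

/-- The positive and negative terminal of each branch. -/
def terminals (C : Circuit m n) : C.Branch → Terminals C.numNodes
  | Sum.inl k => C.port k
  | Sum.inr (Sum.inl k) => C.diode k
  | Sum.inr (Sum.inr (Sum.inl k)) => C.resistor k
  | Sum.inr (Sum.inr (Sum.inr (Sum.inl ⟨t, Sum.inl k⟩))) => C.transformerFirst t k
  | Sum.inr (Sum.inr (Sum.inr (Sum.inl ⟨t, Sum.inr k⟩))) => C.transformerSecond t k
  | Sum.inr (Sum.inr (Sum.inr (Sum.inr (g, k)))) => C.gyrator g k

/-- Branch voltages `v` and branch currents `i` solve the circuit. The voltage of a branch is the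
potential of its positive terminal minus that of its negative terminal, and its current is positive
if it flows through the branch from the positive to the negative terminal. In particular a driving
point current, which flows through the environment, is positive if it leaves the circuit at the
positive terminal. -/
structure IsSolution (C : Circuit m n) (v i : C.Branch → ℝ) : Prop where
  /-- Kirchhoff's voltage law -/
  kvl : ∃ φ : Fin C.numNodes → ℝ, ∀ b, v b = φ (C.terminals b).pos - φ (C.terminals b).neg
  /-- Kirchhoff's current law -/
  kcl : ∀ x : Fin C.numNodes,
    (∑ b, if (C.terminals b).pos = x then i b else 0) =
      ∑ b, if (C.terminals b).neg = x then i b else 0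
  diode_law : ∀ k, v (C.diodeBranch k) ∈ diodeImpedance (i (C.diodeBranch k))
  resistor_law : ∀ k, v (C.resistorBranch k) = C.resistance k * i (C.resistorBranch k)
  transformer_law_first : ∀ t, (fun k => i (C.firstBranch t k)) =
    (C.turnsRatio t)ᵀ *ᵥ (fun k => i (C.secondBranch t k))
  transformer_law_second : ∀ t, (fun k => v (C.secondBranch t k)) =
    -(C.turnsRatio t *ᵥ (fun k => v (C.firstBranch t k)))
  gyrator_law_first : ∀ g,
    v (C.gyratorBranch g 0) = C.gyration g * i (C.gyratorBranch g 1)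
  gyrator_law_second : ∀ g,
    v (C.gyratorBranch g 1) = -(C.gyration g * i (C.gyratorBranch g 0))

/-- The circuit has a solution with driving point voltages `v` and currents `i`, in which the
current through the diode `e (inl j)` from anode to cathode is `iz j`, and the voltage across the
diode `e (inr j)`, taken in the reverse direction (cathode potential minus anode potential), is
`vz j`. -/
def Admits (C : Circuit m n) {p q : ℕ} (e : Fin p ⊕ Fin q ≃ Fin n)
    (v i : Fin m → ℝ) (iz : Fin p → ℝ) (vz : Fin q → ℝ) : Prop :=
  ∃ vb ib : C.Branch → ℝ, C.IsSolution vb ib ∧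
    (∀ k, vb (C.portBranch k) = v k) ∧ (∀ k, ib (C.portBranch k) = i k) ∧
    (∀ j, ib (C.diodeBranch (e (Sum.inl j))) = iz j) ∧
    (∀ j, -vb (C.diodeBranch (e (Sum.inr j))) = vz j)

end Circuit

/-- Hybrid vector: the entries of `a` at the indices in `S`, those of `b` elsewhere. -/
def hybrid {m : ℕ} (S : Finset (Fin m)) (a b : Fin m → ℝ) : Fin m → ℝ :=
  fun k => if k ∈ S then a k else b k

end RTGD

/-! Remove the diodes and let L be the space of voltages and currents that the linear part admits at
the m driving points and n diodes. Two facts about L suffice. It is passive: the branch powers sum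
to zero by Tellegen's theorem and the linear elements absorb nonnegative power, so `v ⬝ᵥ i ≤ 0` on L
(`terminalBehavior_passive`). It is large: its dimension is at least m + n
(`card_le_finrank_terminalBehavior`), even when the element equations are degenerate, because a
solution invisible at the terminals is power-orthogonal to both the Kirchhoff space and the element
space.

A passive space of that dimension is a graph once a suitable voltage or current is chosen as input
at each terminal (`exists_hybrid_matrix`), and its matrix M is negative semidefinite as a form.
Diodes with current input become the forward ones, those with voltage input the reverse ones.
Reordering, changing signs and negating M gives a matrix with nonnegative form whose blocks are H,
B, C, D (`admits_iff_of_graph`). -/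

namespace RTGD

/-! ### Power pairing and the dimension count -/

section Abstract

variable {ι β ε : Type*}

theorem eq_zero_of_forall_quadratic_nonneg {a b : ℝ} (h : ∀ t : ℝ, 0 ≤ t * a + t ^ 2 * b) :
    a = 0 := by
  by_contra ha
  have hd : 0 < |b| + 1 := by positivity
  -- The added 1 keeps the denominator positive and makes the quadratic strictly negative here for
  -- every sign of `b`, including `b = 0`.
  have h1 := h (-a / (|b| + 1))
  have h2 : -a / (|b| + 1) * a + (-a / (|b| + 1)) ^ 2 * b =
      a ^ 2 * (b - (|b| + 1)) / (|b| + 1) ^ 2 := by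
    field_simp
    ring
  rw [h2] at h1
  have h3 : a ^ 2 * (b - (|b| + 1)) / (|b| + 1) ^ 2 < 0 := by
    apply div_neg_of_neg_of_pos _ (by positivity)
    apply mul_neg_of_pos_of_neg (by positivity)
    linarith [le_abs_self b]
  linarith

section

variable [Fintype β]

/-- The pairing `(v, i), (v', i') ↦ v ⬝ᵥ i' + i ⬝ᵥ v'` of voltage-current pairs, the polarization
of twice the power. -/
def powerForm (β : Type*) [Fintype β] : LinearMap.BilinForm ℝ ((β → ℝ) × (β → ℝ)) :=
  LinearMap.mk₂ ℝ (fun x y => x.1 ⬝ᵥ y.2 + x.2 ⬝ᵥ y.1)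
    (fun x x' y => by simp only [Prod.fst_add, Prod.snd_add, add_dotProduct]; ring)
    (fun c x y => by simp only [Prod.smul_fst, Prod.smul_snd, smul_dotProduct, smul_eq_mul]; ring)
    (fun x y y' => by simp only [Prod.fst_add, Prod.snd_add, dotProduct_add]; ring)
    (fun c x y => by simp only [Prod.smul_fst, Prod.smul_snd, dotProduct_smul, smul_eq_mul]; ring)

theorem powerForm_apply (x y : (β → ℝ) × (β → ℝ)) :
    powerForm β x y = x.1 ⬝ᵥ y.2 + x.2 ⬝ᵥ y.1 := rfl

theorem powerForm_isSymm : (powerForm β).IsSymm :=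
  ⟨fun x y => by
    simp only [powerForm_apply]
    rw [dotProduct_comm x.1, dotProduct_comm x.2, add_comm]⟩

theorem powerForm_nondegenerate : (powerForm β).Nondegenerate := by
  refine (LinearMap.IsRefl.nondegenerate_iff_separatingLeft powerForm_isSymm.isRefl).2 ?_
  intro x hx
  -- Pairing with the swapped vector gives the sum of the squared norms of voltages and currents.
  have h1 := hx (x.2, x.1)
  rw [powerForm_apply] at h1
  have h2 : 0 ≤ x.1 ⬝ᵥ x.1 := Finset.sum_nonneg fun _ _ => mul_self_nonneg _
  have h3 : 0 ≤ x.2 ⬝ᵥ x.2 := Finset.sum_nonneg fun _ _ => mul_self_nonneg _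
  dsimp only at h1
  ext k
  · simp [dotProduct_self_eq_zero.1 (show x.1 ⬝ᵥ x.1 = 0 by linarith)]
  · simp [dotProduct_self_eq_zero.1 (show x.2 ⬝ᵥ x.2 = 0 by linarith)]

end

/-- Restriction of branch voltages and currents along `f`. -/
def restrictTo (f : ε → β) : ((β → ℝ) × (β → ℝ)) →ₗ[ℝ] ((ε → ℝ) × (ε → ℝ)) :=
  (LinearMap.funLeft ℝ ℝ f).prodMap (LinearMap.funLeft ℝ ℝ f)

theorem restrictTo_apply (f : ε → β) (x : (β → ℝ) × (β → ℝ)) :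
    restrictTo f x = (x.1 ∘ f, x.2 ∘ f) := rfl

/-- Terminating a self-orthogonal space of branch variables by elements that are passive away from
the branches `f e` leaves enough freedom at the branches `f e`. -/
theorem card_le_finrank_map_restrictTo [Fintype β] [Fintype ε] (f : ε → β) (K F : Submodule ℝ ((β → ℝ) × (β → ℝ)))
    (hK : ∀ x ∈ K, ∀ y ∈ K, x.1 ⬝ᵥ y.2 = 0) (hKdim : Fintype.card β ≤ Module.finrank ℝ K)
    (hF : ∀ x ∈ F, (x.1 ∘ f) ⬝ᵥ (x.2 ∘ f) ≤ x.1 ⬝ᵥ x.2)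
    (hFdim : Fintype.card β + Fintype.card ε ≤ Module.finrank ℝ F) :
    Fintype.card ε ≤ Module.finrank ℝ ((K ⊓ F).map (restrictTo f)) := by
  have key : (K ⊓ F) ⊓ LinearMap.ker (restrictTo f) ≤ (powerForm β).orthogonal (K ⊔ F) := by
    rintro x ⟨⟨hxK, hxF⟩, hx0⟩
    have hK' : K ≤ LinearMap.ker ((powerForm β) x) := by
      intro y hy
      rw [LinearMap.mem_ker, powerForm_apply, hK x hxK y hy, dotProduct_comm, hK y hy x hxK,
        add_zero]
    have hF' : F ≤ LinearMap.ker ((powerForm β) x) := by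
      intro y hy
      rw [LinearMap.mem_ker]
      rw [SetLike.mem_coe, LinearMap.mem_ker, restrictTo_apply, Prod.mk_eq_zero] at hx0
      -- On `F`, total power minus power at `f` is a nonnegative quadratic form. It vanishes at `x`,
      -- by `hK` and `hx0`, so its first variation there, the pairing of `x` with `y`, vanishes too.
      refine eq_zero_of_forall_quadratic_nonneg
        (b := y.1 ⬝ᵥ y.2 - (y.1 ∘ f) ⬝ᵥ (y.2 ∘ f)) fun t => ?_
      have h := hF (x + t • y) (F.add_mem hxF (F.smul_mem t hy))
      have e1 : (x + t • y).1 ∘ f = t • (y.1 ∘ f) := by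
        ext e
        simpa using congrFun hx0.1 e
      have e2 : (x + t • y).2 ∘ f = t • (y.2 ∘ f) := by
        ext e
        simpa using congrFun hx0.2 e
      rw [e1, e2] at h
      simp only [Prod.fst_add, Prod.snd_add, Prod.smul_fst, Prod.smul_snd, add_dotProduct,
        dotProduct_add, smul_dotProduct, dotProduct_smul, smul_eq_mul, hK x hxK x hxK] at h
      rw [powerForm_apply, dotProduct_comm x.2]
      nlinarith
    rw [LinearMap.BilinForm.mem_orthogonal_iff]
    intro y hy
    exact powerForm_isSymm.isRefl _ _ ((sup_le hK' hF') hy)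
  -- By nondegeneracy the kernel of the restriction has dimension at most `2 * card β - dim (K ⊔
  -- F)`. In dim (K ⊓ F) minus this bound, dim (K ⊔ F) cancels, leaving dim K + dim F - 2 card β.
  have h1 := Submodule.finrank_mono key
  have h2 := LinearMap.BilinForm.finrank_orthogonal (powerForm_nondegenerate (β := β)) (K ⊔ F)
  have h3 := Submodule.finrank_sup_add_finrank_inf_eq K F
  have h4 := LinearMap.finrank_range_add_finrank_ker ((restrictTo f).domRestrict (K ⊓ F))
  rw [LinearMap.range_domRestrict] at h4
  have h5 : Module.finrank ℝ (LinearMap.ker ((restrictTo f).domRestrict (K ⊓ F))) =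
      Module.finrank ℝ ↥((K ⊓ F) ⊓ LinearMap.ker (restrictTo f)) := by
    rw [LinearMap.ker_domRestrict]
    rw [(Submodule.equivSubtypeMap (K ⊓ F) _).finrank_eq]
    exact congrArg (fun W : Submodule ℝ ((β → ℝ) × (β → ℝ)) => Module.finrank ℝ W)
      (Submodule.map_comap_subtype _ _)
  have h6 : Module.finrank ℝ ((β → ℝ) × (β → ℝ)) = Fintype.card β + Fintype.card β := by simp
  have h7 := Submodule.finrank_le (K ⊔ F)
  omega

/-! ### Passive spaces as graphs in hybrid coordinates -/

/-- The hybrid coordinates of voltage-current pairs: the voltages at the indices in `S`, the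
currents elsewhere. -/
def hybridCoords [DecidableEq ι] (S : Finset ι) : ((ι → ℝ) × (ι → ℝ)) →ₗ[ℝ] (ι → ℝ) where
  toFun x := S.piecewise x.1 x.2
  map_add' x y := by
    ext k
    by_cases hk : k ∈ S <;> simp [hk]
  map_smul' c x := by
    ext k
    by_cases hk : k ∈ S <;> simp [hk]

theorem hybridCoords_apply [DecidableEq ι] (S : Finset ι) (x : (ι → ℝ) × (ι → ℝ)) :
    hybridCoords S x = S.piecewise x.1 x.2 := rfl

theorem piecewise_dotProduct_piecewise [Fintype ι] [DecidableEq ι] (S : Finset ι) (v i : ι → ℝ) :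
    S.piecewise v i ⬝ᵥ S.piecewise i v = v ⬝ᵥ i := by
  refine Finset.sum_congr rfl fun k _ => ?_
  by_cases hk : k ∈ S <;> simp [hk, mul_comm]

theorem eq_of_piecewise_eq [DecidableEq ι] {S : Finset ι} {v i v' i' : ι → ℝ}
    (h : S.piecewise v i = S.piecewise v' i') (h' : S.piecewise i v = S.piecewise i' v') :
    (v, i) = (v', i') := by
  ext k <;> have h1 := congrFun h k <;> have h2 := congrFun h' k <;>
    by_cases hk : k ∈ S <;> simp_all

/-- In a passive space some set of voltages, complemented by the remaining currents, determines
all variables. -/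
theorem exists_hybridCoords_injective [Fintype ι] [DecidableEq ι]
    (L : Submodule ℝ ((ι → ℝ) × (ι → ℝ))) (hL : ∀ x ∈ L, x.1 ⬝ᵥ x.2 ≤ 0) :
    ∃ S : Finset ι, ∀ x ∈ L, hybridCoords S x = 0 → x = 0 := by
  classical
  have horth : ∀ x ∈ L, ∀ y ∈ L, y.1 = 0 → x.1 ⬝ᵥ y.2 = 0 := by
    intro x hx y hy hy0
    rw [← neg_eq_zero]
    refine eq_zero_of_forall_quadratic_nonneg (b := -(x.1 ⬝ᵥ x.2)) fun t => ?_
    have h := hL (t • x + y) (L.add_mem (L.smul_mem t hx) hy)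
    simp only [Prod.fst_add, Prod.snd_add, Prod.smul_fst, Prod.smul_snd, add_dotProduct,
      dotProduct_add, smul_dotProduct, dotProduct_smul, smul_eq_mul, hy0, zero_dotProduct] at h
    nlinarith
  -- The voltages on `S` determine all voltages in `L`; a smallest such `S` is used.
  let P : Finset ι → Prop := fun S => ∀ x ∈ L, (∀ k ∈ S, x.1 k = 0) → x.1 = 0
  obtain ⟨S, hS, hmin⟩ := Finset.exists_min_image (Finset.univ.filter P) Finset.card
    ⟨Finset.univ, by
      simp only [P, Finset.mem_filter, Finset.mem_univ, true_and]
      exact fun x _ h => funext fun k => h k trivial⟩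
  rw [Finset.mem_filter] at hS
  refine ⟨S, fun y hy hy0 => ?_⟩
  rw [hybridCoords_apply] at hy0
  have hv : y.1 = 0 := hS.2 y hy fun k hk => by simpa [hk] using congrFun hy0 k
  refine Prod.ext hv (funext fun k => ?_)
  by_cases hk : k ∈ S
  · have hk' : ¬ P (S.erase k) := fun h => by
      have h1 := hmin (S.erase k) (by simp [h])
      have h2 := Finset.card_erase_lt_of_mem hk
      omega
    simp only [P] at hk'
    push Not at hk'
    obtain ⟨x, hx, hx0, hxne⟩ := hk'
    have hxk : x.1 k ≠ 0 := fun h => hxne <| hS.2 x hx fun l hl => by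
      by_cases hlk : l = k
      · rw [hlk, h]
      · exact hx0 l (Finset.mem_erase.2 ⟨hlk, hl⟩)
    have h := horth x hx y hy hv
    rw [dotProduct, Finset.sum_eq_single k] at h
    · exact (mul_eq_zero.1 h).resolve_left hxk
    · intro l _ hlk
      by_cases hl : l ∈ S
      · rw [hx0 l (Finset.mem_erase.2 ⟨hlk, hl⟩), zero_mul]
      · rw [show y.2 l = 0 by simpa [hl] using congrFun hy0 l, mul_zero]
    · simp
  · simpa [hk] using congrFun hy0 k

/-- A passive space of voltage-current pairs of full dimension is the graph of a linear map in
suitable hybrid coordinates. -/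
theorem exists_hybrid_matrix [Fintype ι] [DecidableEq ι] (L : Submodule ℝ ((ι → ℝ) × (ι → ℝ)))
    (hL : ∀ x ∈ L, x.1 ⬝ᵥ x.2 ≤ 0) (hdim : Fintype.card ι ≤ Module.finrank ℝ L) :
    ∃ (S : Finset ι) (M : Matrix ι ι ℝ), (∀ u, u ⬝ᵥ (M *ᵥ u) ≤ 0) ∧
      ∀ v i : ι → ℝ, (v, i) ∈ L ↔ S.piecewise i v = M *ᵥ S.piecewise v i := by
  obtain ⟨S, hS⟩ := exists_hybridCoords_injective L hL
  let T : L →ₗ[ℝ] (ι → ℝ) := (hybridCoords S).domRestrict L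
  have hT : Function.Injective T :=
    (injective_iff_map_eq_zero T).2 fun x hx => Subtype.ext (hS x x.2 hx)
  have hcard : Module.finrank ℝ L = Module.finrank ℝ (ι → ℝ) :=
    le_antisymm (LinearMap.finrank_le_finrank_of_injective hT) (by simpa using hdim)
  let E : L ≃ₗ[ℝ] (ι → ℝ) := T.linearEquivOfInjective hT hcard
  have hE : ∀ x : L, E x = S.piecewise x.1.1 x.1.2 := fun x => rfl
  -- Swapping voltages and currents before `hybridCoords S` gives the complementary coordinates, the
  -- outputs.
  let M : Matrix ι ι ℝ := LinearMap.toMatrix'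
    ((hybridCoords S ∘ₗ (LinearEquiv.prodComm ℝ (ι → ℝ) (ι → ℝ)).toLinearMap ∘ₗ L.subtype) ∘ₗ
      E.symm.toLinearMap)
  have hM : ∀ x : L, M *ᵥ E x = S.piecewise x.1.2 x.1.1 := fun x => by
    simp only [M]
    rw [← Matrix.toLin'_apply, Matrix.toLin'_toMatrix']
    simp [hybridCoords_apply]
  refine ⟨S, M, fun u => ?_, fun v i => ⟨fun h => ?_, fun h => ?_⟩⟩
  · obtain ⟨x, rfl⟩ := E.surjective u
    rw [hM, hE, piecewise_dotProduct_piecewise]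
    exact hL x x.2
  · exact (hM ⟨(v, i), h⟩).symm
  · obtain ⟨x, hx⟩ := E.surjective (S.piecewise v i)
    have h1 := hM x
    rw [hx, ← h] at h1
    rw [hE] at hx
    rw [eq_of_piecewise_eq hx.symm h1]
    exact x.2

end Abstract

/-! ### Kirchhoff's laws -/

namespace Circuit

variable {m n : ℕ} (C : Circuit m n)

/-- The incidence matrix of the circuit graph. -/
def incidence : Matrix (Fin C.numNodes) C.Branch ℝ := fun x b =>
  (if (C.terminals b).pos = x then 1 else 0) - (if (C.terminals b).neg = x then 1 else 0)

/-- The branch voltages and currents obeying Kirchhoff's laws. -/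
def kirchhoff : Submodule ℝ ((C.Branch → ℝ) × (C.Branch → ℝ)) :=
  (LinearMap.range C.incidenceᵀ.mulVecLin).prod (LinearMap.ker C.incidence.mulVecLin)

theorem mem_kirchhoff (v i : C.Branch → ℝ) :
    (v, i) ∈ C.kirchhoff ↔
      (∃ φ : Fin C.numNodes → ℝ, ∀ b, v b = φ (C.terminals b).pos - φ (C.terminals b).neg) ∧
      ∀ x : Fin C.numNodes, (∑ b, if (C.terminals b).pos = x then i b else 0) =
        ∑ b, if (C.terminals b).neg = x then i b else 0 := by
  rw [kirchhoff, Submodule.mem_prod]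
  refine and_congr (exists_congr fun φ => ?_) ?_
  · rw [eq_comm, funext_iff]
    refine forall_congr' fun b => ?_
    rw [Matrix.mulVecLin_apply]
    simp only [Matrix.mulVec, Matrix.transpose_apply, dotProduct, incidence, sub_mul, ite_mul,
      one_mul, zero_mul, Finset.sum_sub_distrib, Finset.sum_ite_eq, Finset.mem_univ, if_true]
  · rw [LinearMap.mem_ker, funext_iff]
    refine forall_congr' fun x => ?_
    rw [Matrix.mulVecLin_apply]
    simp only [Matrix.mulVec, dotProduct, incidence, sub_mul, ite_mul, one_mul, zero_mul,
      Finset.sum_sub_distrib, Pi.zero_apply, sub_eq_zero]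

/-- Tellegen's theorem: potential differences lie in the row space of the incidence matrix, currents
in its kernel. -/
theorem kirchhoff_dotProduct_eq_zero {x y : (C.Branch → ℝ) × (C.Branch → ℝ)}
    (hx : x ∈ C.kirchhoff) (hy : y ∈ C.kirchhoff) : x.1 ⬝ᵥ y.2 = 0 := by
  obtain ⟨⟨φ, hφ⟩, -⟩ := hx
  have hy2 : C.incidence *ᵥ y.2 = 0 := hy.2
  rw [← hφ, Matrix.mulVecLin_apply, Matrix.mulVec_transpose, ← Matrix.dotProduct_mulVec, hy2,
    dotProduct_zero]

/-- Row rank equals column rank, so the voltage and current spaces have complementary dimensions. -/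
theorem card_le_finrank_kirchhoff :
    Fintype.card C.Branch ≤ Module.finrank ℝ C.kirchhoff := by
  have h1 := LinearMap.finrank_le_finrank_of_injective
    (f := (((LinearMap.range C.incidenceᵀ.mulVecLin).subtype.prodMap
      (LinearMap.ker C.incidence.mulVecLin).subtype).codRestrict C.kirchhoff
        fun x => ⟨x.1.2, x.2.2⟩))
    (Function.Injective.of_comp (f := Subtype.val)
      (Function.Injective.prodMap Subtype.val_injective Subtype.val_injective))
  rw [Module.finrank_prod] at h1
  have h2 := LinearMap.finrank_range_add_finrank_ker C.incidence.mulVecLin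
  have h3 := Matrix.rank_transpose C.incidence
  rw [Matrix.rank, Matrix.rank] at h3
  rw [Module.finrank_fintype_fun_eq_card] at h2
  omega

/-! ### Laws of the linear elements -/

/-- The branches of resistors, transformers and gyrators. -/
abbrev ElementBranch : Type :=
  Fin C.numResistors ⊕
    (Σ t : Fin C.numTransformers, Fin (C.numFirst t) ⊕ Fin (C.numSecond t)) ⊕
    (Fin C.numGyrators × Fin 2)

/-- The failure of the laws of the linear elements, one equation for each element branch. -/
def lawDefectFun (v i : C.Branch → ℝ) : C.ElementBranch → ℝ
  | Sum.inl k => v (C.resistorBranch k) - C.resistance k * i (C.resistorBranch k)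
  | Sum.inr (Sum.inl ⟨t, Sum.inl k⟩) =>
    i (C.firstBranch t k) - ((C.turnsRatio t)ᵀ *ᵥ (fun k => i (C.secondBranch t k))) k
  | Sum.inr (Sum.inl ⟨t, Sum.inr k⟩) =>
    v (C.secondBranch t k) + (C.turnsRatio t *ᵥ (fun k => v (C.firstBranch t k))) k
  | Sum.inr (Sum.inr (g, 0)) =>
    v (C.gyratorBranch g 0) - C.gyration g * i (C.gyratorBranch g 1)
  | Sum.inr (Sum.inr (g, 1)) =>
    v (C.gyratorBranch g 1) + C.gyration g * i (C.gyratorBranch g 0)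

/-- `lawDefectFun` as a linear map. -/
def lawDefect : ((C.Branch → ℝ) × (C.Branch → ℝ)) →ₗ[ℝ] (C.ElementBranch → ℝ) where
  toFun x := C.lawDefectFun x.1 x.2
  map_add' x y := by
    ext b
    rcases b with k | ⟨t, k | k⟩ | ⟨g, k⟩
    · simp only [lawDefectFun, Prod.fst_add, Prod.snd_add, Pi.add_apply]
      ring
    · simp only [lawDefectFun, Prod.snd_add, Pi.add_apply, Matrix.mulVec,
        dotProduct, mul_add, Finset.sum_add_distrib]
      ring
    · simp only [lawDefectFun, Prod.fst_add, Pi.add_apply, Matrix.mulVec,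
        dotProduct, mul_add, Finset.sum_add_distrib]
      ring
    · fin_cases k <;> simp [lawDefectFun] <;> ring
  map_smul' c x := by
    ext b
    rcases b with k | ⟨t, k | k⟩ | ⟨g, k⟩
    · simp [lawDefectFun]
      ring
    · simp [lawDefectFun, Matrix.mulVec, dotProduct, mul_sub, Finset.mul_sum, mul_left_comm]
    · simp [lawDefectFun, Matrix.mulVec, dotProduct, mul_add, Finset.mul_sum, mul_left_comm]
    · fin_cases k <;> simp [lawDefectFun] <;> ring

/-- The branch voltages and currents obeying the laws of the linear elements. -/
def elementLaws : Submodule ℝ ((C.Branch → ℝ) × (C.Branch → ℝ)) := LinearMap.ker C.lawDefect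

theorem mem_elementLaws (v i : C.Branch → ℝ) :
    (v, i) ∈ C.elementLaws ↔
      (∀ k, v (C.resistorBranch k) = C.resistance k * i (C.resistorBranch k)) ∧
      (∀ t, (fun k => i (C.firstBranch t k)) =
        (C.turnsRatio t)ᵀ *ᵥ (fun k => i (C.secondBranch t k))) ∧
      (∀ t, (fun k => v (C.secondBranch t k)) =
        -(C.turnsRatio t *ᵥ (fun k => v (C.firstBranch t k)))) ∧
      (∀ g, v (C.gyratorBranch g 0) = C.gyration g * i (C.gyratorBranch g 1)) ∧
      (∀ g, v (C.gyratorBranch g 1) = -(C.gyration g * i (C.gyratorBranch g 0))) := by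
  rw [elementLaws, LinearMap.mem_ker]
  constructor
  · intro h
    refine ⟨fun k => ?_, fun t => funext fun k => ?_, fun t => funext fun k => ?_, fun g => ?_,
      fun g => ?_⟩
    · exact sub_eq_zero.1 (congrFun h (Sum.inl k))
    · exact sub_eq_zero.1 (congrFun h (Sum.inr (Sum.inl ⟨t, Sum.inl k⟩)))
    · exact eq_neg_of_add_eq_zero_left (congrFun h (Sum.inr (Sum.inl ⟨t, Sum.inr k⟩)))
    · exact sub_eq_zero.1 (congrFun h (Sum.inr (Sum.inr (g, 0))))
    · exact eq_neg_of_add_eq_zero_left (congrFun h (Sum.inr (Sum.inr (g, 1))))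
  · rintro ⟨h1, h2, h3, h4, h5⟩
    ext b
    rcases b with k | ⟨t, k | k⟩ | ⟨g, k⟩
    · exact sub_eq_zero.2 (h1 k)
    · exact sub_eq_zero.2 (congrFun (h2 t) k)
    · exact eq_neg_iff_add_eq_zero.1 (congrFun (h3 t) k)
    · fin_cases k
      · exact sub_eq_zero.2 (h4 g)
      · exact eq_neg_iff_add_eq_zero.1 (h5 g)

/-- The branches of driving points and diodes. -/
def terminalBranch : Fin m ⊕ Fin n → C.Branch := Sum.elim C.portBranch C.diodeBranch

/-- There is one linear equation per element branch, and each cuts the dimension by at most one. -/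
theorem card_le_finrank_elementLaws :
    Fintype.card C.Branch + Fintype.card (Fin m ⊕ Fin n) ≤ Module.finrank ℝ C.elementLaws := by
  have h1 := LinearMap.finrank_range_add_finrank_ker C.lawDefect
  have h2 := Submodule.finrank_le (LinearMap.range C.lawDefect)
  have h3 : Fintype.card C.Branch =
      Fintype.card (Fin m ⊕ Fin n) + Fintype.card C.ElementBranch := by
    simp only [Fintype.card_sum]
    omega
  rw [Module.finrank_prod, Module.finrank_fintype_fun_eq_card] at h1
  rw [Module.finrank_fintype_fun_eq_card] at h2
  rw [elementLaws]
  omega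

/-- Transformers and gyrators are lossless and resistors dissipate. -/
theorem elementLaws_passive {x : (C.Branch → ℝ) × (C.Branch → ℝ)} (hx : x ∈ C.elementLaws) :
    (x.1 ∘ C.terminalBranch) ⬝ᵥ (x.2 ∘ C.terminalBranch) ≤ x.1 ⬝ᵥ x.2 := by
  obtain ⟨v, i⟩ := x
  obtain ⟨h1, h2, h3, h4, h5⟩ := (C.mem_elementLaws v i).1 hx
  have hr : 0 ≤ ∑ k, v (C.resistorBranch k) * i (C.resistorBranch k) :=
    Finset.sum_nonneg fun k _ => by
      rw [h1 k, mul_assoc]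
      exact mul_nonneg (C.resistance_nonneg k) (mul_self_nonneg _)
  have ht : ∀ t, ∑ k, v (C.firstBranch t k) * i (C.firstBranch t k) +
      ∑ k, v (C.secondBranch t k) * i (C.secondBranch t k) = 0 := fun t => by
    change (fun k => v (C.firstBranch t k)) ⬝ᵥ (fun k => i (C.firstBranch t k)) +
      (fun k => v (C.secondBranch t k)) ⬝ᵥ (fun k => i (C.secondBranch t k)) = 0
    rw [h2 t, h3 t, neg_dotProduct, Matrix.mulVec_transpose, dotProduct_comm,
      ← Matrix.dotProduct_mulVec, dotProduct_comm, add_neg_cancel]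
  have hg : ∀ g, v (C.gyratorBranch g 0) * i (C.gyratorBranch g 0) +
      v (C.gyratorBranch g 1) * i (C.gyratorBranch g 1) = 0 := fun g => by
    rw [h4 g, h5 g]
    ring
  have e : v ⬝ᵥ i = (v ∘ C.terminalBranch) ⬝ᵥ (i ∘ C.terminalBranch) +
      (∑ k, v (C.resistorBranch k) * i (C.resistorBranch k) +
        (∑ t, (∑ k, v (C.firstBranch t k) * i (C.firstBranch t k) +
          ∑ k, v (C.secondBranch t k) * i (C.secondBranch t k)) +
        ∑ g, (v (C.gyratorBranch g 0) * i (C.gyratorBranch g 0) +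
          v (C.gyratorBranch g 1) * i (C.gyratorBranch g 1)))) := by
    simp only [dotProduct, Fintype.sum_sum_type, Fintype.sum_sigma, Fintype.sum_prod_type,
      Fin.sum_univ_two, add_assoc, Function.comp_apply, terminalBranch, Sum.elim_inl, Sum.elim_inr]
    rfl
  simp only [ht, hg, Finset.sum_const_zero, add_zero] at e
  change _ ≤ v ⬝ᵥ i
  rw [e]
  exact le_add_of_nonneg_right hr

/-! ### Behavior at driving points and diodes -/

/-- The voltages and currents at the driving points and diodes that the linear part of the circuit
admits. -/
def terminalBehavior : Submodule ℝ ((Fin m ⊕ Fin n → ℝ) × (Fin m ⊕ Fin n → ℝ)) :=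
  (C.kirchhoff ⊓ C.elementLaws).map (restrictTo C.terminalBranch)

theorem terminalBehavior_passive {x : (Fin m ⊕ Fin n → ℝ) × (Fin m ⊕ Fin n → ℝ)}
    (hx : x ∈ C.terminalBehavior) : x.1 ⬝ᵥ x.2 ≤ 0 := by
  obtain ⟨y, ⟨hyK, hyF⟩, rfl⟩ := hx
  exact (C.elementLaws_passive hyF).trans_eq (C.kirchhoff_dotProduct_eq_zero hyK hyK)

theorem card_le_finrank_terminalBehavior :
    Fintype.card (Fin m ⊕ Fin n) ≤ Module.finrank ℝ C.terminalBehavior :=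
  card_le_finrank_map_restrictTo C.terminalBranch C.kirchhoff C.elementLaws
    (fun _ hx _ hy => C.kirchhoff_dotProduct_eq_zero hx hy) C.card_le_finrank_kirchhoff
    (fun _ hx => C.elementLaws_passive hx) C.card_le_finrank_elementLaws

theorem admits_iff {p q : ℕ} (e : Fin p ⊕ Fin q ≃ Fin n) (v i : Fin m → ℝ) (iz : Fin p → ℝ)
    (vz : Fin q → ℝ) :
    C.Admits e v i iz vz ↔ ∃ vd id : Fin n → ℝ,
      (Sum.elim v vd, Sum.elim i id) ∈ C.terminalBehavior ∧
      (∀ k, vd k ∈ diodeImpedance (id k)) ∧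
      (∀ j, id (e (Sum.inl j)) = iz j) ∧ (∀ j, -vd (e (Sum.inr j)) = vz j) := by
  constructor
  · rintro ⟨vb, ib, h, hv, hi, hiz, hvz⟩
    refine ⟨fun k => vb (C.diodeBranch k), fun k => ib (C.diodeBranch k),
      ⟨(vb, ib), ⟨(C.mem_kirchhoff _ _).2 ⟨h.kvl, h.kcl⟩, (C.mem_elementLaws _ _).2
        ⟨h.resistor_law, h.transformer_law_first, h.transformer_law_second,
          h.gyrator_law_first, h.gyrator_law_second⟩⟩, ?_⟩, h.diode_law, hiz, hvz⟩
    rw [restrictTo_apply]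
    ext (k | k)
    exacts [hv k, rfl, hi k, rfl]
  · rintro ⟨vd, id, ⟨⟨vb, ib⟩, ⟨hK, hF⟩, h⟩, hd, hiz, hvz⟩
    rw [restrictTo_apply, Prod.mk.injEq] at h
    have hv : ∀ k, vb (C.portBranch k) = v k := fun k => congrFun h.1 (Sum.inl k)
    have hi : ∀ k, ib (C.portBranch k) = i k := fun k => congrFun h.2 (Sum.inl k)
    have hvd : ∀ k, vb (C.diodeBranch k) = vd k := fun k => congrFun h.1 (Sum.inr k)
    have hid : ∀ k, ib (C.diodeBranch k) = id k := fun k => congrFun h.2 (Sum.inr k)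
    obtain ⟨hkvl, hkcl⟩ := (C.mem_kirchhoff _ _).1 hK
    obtain ⟨h1, h2, h3, h4, h5⟩ := (C.mem_elementLaws _ _).1 hF
    refine ⟨vb, ib, ⟨hkvl, hkcl, fun k => ?_, h1, h2, h3, h4, h5⟩, hv, hi, fun j => ?_,
      fun j => ?_⟩
    · rw [hvd, hid]
      exact hd k
    · rw [hid]
      exact hiz j
    · rw [hvd]
      exact hvz j

end Circuit

/-! ### From the graph to the complementarity system -/

theorem PosSemidefForm.toBlocks {α β : Type*} [Fintype α] [Fintype β]
    {H : Matrix α α ℝ} {B : Matrix α β ℝ} {C : Matrix β α ℝ} {D : Matrix β β ℝ}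
    (h : PosSemidefForm (Matrix.fromBlocks H B C D)) : PosSemidefForm H ∧ PosSemidefForm D := by
  refine ⟨fun x => ?_, fun x => ?_⟩
  · simpa [Matrix.fromBlocks_mulVec, sumElim_dotProduct_sumElim] using h (Sum.elim x 0)
  · simpa [Matrix.fromBlocks_mulVec, sumElim_dotProduct_sumElim] using h (Sum.elim 0 x)

/-- The negative of `M` after a reindexing by `f` and a change of the signs of coordinates. -/
def negRescale {α β : Type*} (M : Matrix β β ℝ) (f : α ≃ β) (σ : α → ℝ) : Matrix α α ℝ :=
  fun a b => -(σ a * M (f a) (f b) * σ b)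

section

variable {α β : Type*} [Fintype α] [Fintype β] {M : Matrix β β ℝ} {f : α ≃ β} {σ : α → ℝ}

theorem negRescale_mulVec {x : α → ℝ} {y : β → ℝ} (h : ∀ a, y (f a) = σ a * x a) (a : α) :
    (negRescale M f σ *ᵥ x) a = -(σ a * (M *ᵥ y) (f a)) := by
  simp only [Matrix.mulVec, dotProduct, negRescale, ← f.sum_comp, h, Finset.mul_sum]
  rw [← Finset.sum_neg_distrib]
  exact Finset.sum_congr rfl fun b _ => by ring

/-- Up to reindexing this is a congruence by a diagonal matrix, followed by negation. -/
theorem PosSemidefForm.negRescale (hM : ∀ y, y ⬝ᵥ (M *ᵥ y) ≤ 0) :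
    PosSemidefForm (negRescale M f σ) := by
  intro x
  let y : β → ℝ := fun b => σ (f.symm b) * x (f.symm b)
  have h : ∀ a, y (f a) = σ a * x a := fun a => by simp [y]
  have e : x ⬝ᵥ (RTGD.negRescale M f σ *ᵥ x) = -(y ⬝ᵥ (M *ᵥ y)) := by
    rw [dotProduct, dotProduct, ← f.sum_comp, ← Finset.sum_neg_distrib]
    refine Finset.sum_congr rfl fun a _ => ?_
    rw [negRescale_mulVec h, h]
    ring
  rw [e]
  exact neg_nonneg.2 (hM _)

end

theorem zero_mem_singleton_add_add_singleton {V : Type*} [AddCommGroup V] (a b : V) (s : Set V) :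
    0 ∈ {a} + s + {b} ↔ -(a + b) ∈ s := by
  simp only [Set.mem_add, Set.mem_singleton_iff, exists_eq_left]
  constructor
  · rintro ⟨_, ⟨w, hw, rfl⟩, h⟩
    rwa [show -(a + b) = w by rw [← sub_eq_zero, ← neg_eq_zero, ← h]; abel]
  · exact fun h => ⟨_, ⟨_, h, rfl⟩, by abel⟩

/-- The sign by which a diode coordinate differs from its forward reference direction. -/
def diodeSign (p q : ℕ) : Fin p ⊕ Fin q → ℝ := Sum.elim 1 (-1)

/-- The diodes in their new order, followed by the driving points. -/
def stackedEquiv {m n p q : ℕ} (e : Fin p ⊕ Fin q ≃ Fin n) :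
    (Fin p ⊕ Fin q) ⊕ Fin m ≃ Fin m ⊕ Fin n :=
  (e.sumCongr (Equiv.refl _)).trans (Equiv.sumComm _ _)

@[simp]
theorem stackedEquiv_inl {m n p q : ℕ} (e : Fin p ⊕ Fin q ≃ Fin n) (j : Fin p ⊕ Fin q) :
    stackedEquiv (m := m) e (Sum.inl j) = Sum.inr (e j) := rfl

@[simp]
theorem stackedEquiv_inr {m n p q : ℕ} (e : Fin p ⊕ Fin q ≃ Fin n) (k : Fin m) :
    stackedEquiv e (Sum.inr k) = Sum.inl k := rfl

/-- If the terminal behavior of a circuit is a graph in hybrid coordinates, its diodes and driving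
points obey a complementarity system. -/
theorem Circuit.admits_iff_of_graph {m n : ℕ} (𝒞 : Circuit m n) {p q : ℕ}
    (e : Fin p ⊕ Fin q ≃ Fin n) {S : Finset (Fin m ⊕ Fin n)} {S' : Finset (Fin m)}
    (hS' : ∀ k, k ∈ S' ↔ Sum.inl k ∈ S) (hp : ∀ j, Sum.inr (e (Sum.inl j)) ∉ S)
    (hq : ∀ j, Sum.inr (e (Sum.inr j)) ∈ S) {M : Matrix (Fin m ⊕ Fin n) (Fin m ⊕ Fin n) ℝ}
    (hM : ∀ v i, (v, i) ∈ 𝒞.terminalBehavior ↔ S.piecewise i v = M *ᵥ S.piecewise v i)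
    {H : Matrix (Fin p ⊕ Fin q) (Fin p ⊕ Fin q) ℝ} {B : Matrix (Fin p ⊕ Fin q) (Fin m) ℝ}
    {C : Matrix (Fin m) (Fin p ⊕ Fin q) ℝ} {D : Matrix (Fin m) (Fin m) ℝ}
    (hN : Matrix.fromBlocks H B C D =
      negRescale M (stackedEquiv e) (Sum.elim (diodeSign p q) 1))
    (v i : Fin m → ℝ) (iz : Fin p → ℝ) (vz : Fin q → ℝ) :
    𝒞.Admits e v i iz vz ↔
      (0 ∈ ({H *ᵥ Sum.elim iz vz} : Set (Fin p ⊕ Fin q → ℝ)) + ZY iz vz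
          + {B *ᵥ hybrid S' v i}) ∧
      hybrid S' i v = -(C *ᵥ Sum.elim iz vz) - D *ᵥ hybrid S' v i := by
  have hport : ∀ (a b : Fin m → ℝ) (a' b' : Fin n → ℝ) k,
      S.piecewise (Sum.elim a a') (Sum.elim b b') (Sum.inl k) = hybrid S' a b k := by
    intro a b a' b' k
    by_cases hk : Sum.inl k ∈ S <;> simp [hybrid, hS', hk]
  set x := Sum.elim iz vz with hx
  set u := hybrid S' v i with hu
  have hgraph : ∀ vd id : Fin n → ℝ, (∀ j, id (e (Sum.inl j)) = iz j) →
      (∀ j, -vd (e (Sum.inr j)) = vz j) →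
      ((Sum.elim v vd, Sum.elim i id) ∈ 𝒞.terminalBehavior ↔
        (∀ j, vd (e (Sum.inl j)) = (-(H *ᵥ x + B *ᵥ u)) (Sum.inl j)) ∧
        (∀ j, -id (e (Sum.inr j)) = (-(H *ᵥ x + B *ᵥ u)) (Sum.inr j)) ∧
        hybrid S' i v = -(C *ᵥ x) - D *ᵥ u) := by
    intro vd id hiz hvz
    -- The graph takes forward voltages as inputs while `vz` holds reverse voltages, hence the sign
    -- -1 on the second group of diodes.
    have hin : ∀ a, S.piecewise (Sum.elim v vd) (Sum.elim i id)
        (stackedEquiv e a) =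
        Sum.elim (diodeSign p q) 1 a * Sum.elim x u a := by
      rintro ((j | j) | k)
      · simp [hp, diodeSign, hx, hiz]
      · simp [hq, diodeSign, hx, ← hvz]
      · simpa using hport v i vd id k
    have hmul := negRescale_mulVec (M := M) hin
    rw [← hN, Matrix.fromBlocks_mulVec] at hmul
    simp only [Sum.elim_comp_inl, Sum.elim_comp_inr] at hmul
    rw [hM, funext_iff, (stackedEquiv e).surjective.forall,
      Sum.forall, Sum.forall, and_assoc]
    refine and_congr (forall_congr' fun j => ?_) (and_congr (forall_congr' fun j => ?_) ?_)
    · have h := hmul (Sum.inl (Sum.inl j))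
      simp only [Sum.elim_inl, diodeSign, Pi.one_apply, one_mul, stackedEquiv_inl] at h
      rw [Pi.neg_apply, h, neg_neg, stackedEquiv_inl, Finset.piecewise_eq_of_notMem _ _ _ (hp j),
        Sum.elim_inr]
    · have h := hmul (Sum.inl (Sum.inr j))
      simp only [Sum.elim_inl, Sum.elim_inr, diodeSign, Pi.neg_apply, Pi.one_apply, neg_one_mul,
        neg_neg, stackedEquiv_inl] at h
      rw [Pi.neg_apply, h, neg_inj, stackedEquiv_inl, Finset.piecewise_eq_of_mem _ _ _ (hq j),
        Sum.elim_inr]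
    · rw [funext_iff]
      refine forall_congr' fun k => ?_
      have h := hmul (Sum.inr k)
      simp only [Sum.elim_inr, Pi.one_apply, one_mul, stackedEquiv_inr] at h
      rw [← neg_add', Pi.neg_apply, h, neg_neg, stackedEquiv_inr, hport]
  rw [Circuit.admits_iff, zero_mem_singleton_add_add_singleton]
  constructor
  · rintro ⟨vd, id, hL, hd, hiz, hvz⟩
    obtain ⟨h1, h2, h3⟩ := (hgraph vd id hiz hvz).1 hL
    refine ⟨⟨fun j => ?_, fun j => ?_⟩, h3⟩
    · simpa only [h1, hiz] using hd (e (Sum.inl j))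
    · simpa only [h2, hvz] using (mem_diodeImpedance_iff_neg _ _).1 (hd (e (Sum.inr j)))
  · rintro ⟨⟨hz, hy⟩, h3⟩
    -- The inclusion leaves `w` as the only candidate for the diode outputs: forward voltages of the
    -- first group, reverse currents of the second.
    set w := -(H *ᵥ x + B *ᵥ u) with hw
    let vd : Fin n → ℝ := fun k => Sum.elim (fun j => w (Sum.inl j)) (fun j => -vz j) (e.symm k)
    let id : Fin n → ℝ := fun k => Sum.elim iz (fun j => -w (Sum.inr j)) (e.symm k)
    have hiz : ∀ j, id (e (Sum.inl j)) = iz j := fun j => by simp [id]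
    have hvz : ∀ j, -vd (e (Sum.inr j)) = vz j := fun j => by simp [vd]
    have hwz : ∀ j, vd (e (Sum.inl j)) = w (Sum.inl j) := fun j => by simp [vd]
    have hwy : ∀ j, -id (e (Sum.inr j)) = w (Sum.inr j) := fun j => by simp [id]
    refine ⟨vd, id, (hgraph vd id hiz hvz).2 ⟨hwz, hwy, h3⟩, fun k => ?_, hiz, hvz⟩
    obtain ⟨j | j, rfl⟩ := e.surjective k
    · rw [hiz, hwz]
      exact hz j
    · rw [mem_diodeImpedance_iff_neg, hvz, hwy]
      exact hy j

end RTGD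

/-- `S` is the set of driving points whose voltage is an input. Hence `u = hybrid S v i` and
`y = hybrid S i v`. -/
theorem mainTheorem1 (m n : ℕ) (𝒞 : RTGD.Circuit m n) :
    ∃ (S : Finset (Fin m)) (p q : ℕ) (e : Fin p ⊕ Fin q ≃ Fin n)
      (H : Matrix (Fin p ⊕ Fin q) (Fin p ⊕ Fin q) ℝ)
      (B : Matrix (Fin p ⊕ Fin q) (Fin m) ℝ)
      (C : Matrix (Fin m) (Fin p ⊕ Fin q) ℝ)
      (D : Matrix (Fin m) (Fin m) ℝ),
      p + q = n ∧ RTGD.PosSemidefForm H ∧ RTGD.PosSemidefForm D ∧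
      ∀ (v i : Fin m → ℝ) (iz : Fin p → ℝ) (vz : Fin q → ℝ),
        𝒞.Admits e v i iz vz ↔
          (0 ∈ ({H *ᵥ Sum.elim iz vz} : Set (Fin p ⊕ Fin q → ℝ)) + RTGD.ZY iz vz
              + {B *ᵥ RTGD.hybrid S v i}) ∧
          RTGD.hybrid S i v = -(C *ᵥ Sum.elim iz vz) - D *ᵥ RTGD.hybrid S v i := by
  obtain ⟨S, M, hneg, hM⟩ := RTGD.exists_hybrid_matrix 𝒞.terminalBehavior
    (fun _ hx => 𝒞.terminalBehavior_passive hx) 𝒞.card_le_finrank_terminalBehavior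
  -- Diodes whose current is an input of the graph form the forward group.
  let P : Fin n → Prop := fun k => Sum.inr k ∉ S
  let e : Fin (Fintype.card {k // P k}) ⊕ Fin (Fintype.card {k // ¬P k}) ≃ Fin n :=
    ((Fintype.equivFin _).symm.sumCongr (Fintype.equivFin _).symm).trans (Equiv.sumCompl P)
  let N := RTGD.negRescale M (RTGD.stackedEquiv e) (Sum.elim (RTGD.diodeSign _ _) 1)
  have hN := RTGD.PosSemidefForm.negRescale hneg
    (f := RTGD.stackedEquiv e)
    (σ := Sum.elim (RTGD.diodeSign _ _) 1)
  rw [← Matrix.fromBlocks_toBlocks (RTGD.negRescale _ _ _)] at hN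
  refine ⟨Finset.univ.filter fun k => Sum.inl k ∈ S, _, _, e, N.toBlocks₁₁, N.toBlocks₁₂,
    N.toBlocks₂₁, N.toBlocks₂₂, by simpa using Fintype.card_congr e, hN.toBlocks.1,
    hN.toBlocks.2, 𝒞.admits_iff_of_graph e (S := S) (by simp) (fun j => ?_) (fun j => ?_) hM
      (Matrix.fromBlocks_toBlocks N)⟩
  · exact ((Fintype.equivFin {k // P k}).symm j).2
  · exact not_not.1 ((Fintype.equivFin {k // ¬P k}).symm j).2
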